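/- Let $(\Delta,\mathcal D,\mathbb P)$ be a probability space, and let state and input constraint sets $\mathbb X\subseteq(\mathbb R^{n_x})^{N+1}$, $\mathbb U\subseteq(\mathbb R^{n_u})^{N+1}$, dynamics $f$, an initial state $x_{\mathrm{init}}$, a stage cost $J$ and a constraint function $g$ with values in $\mathbb R^q$ be given. A decision is a pair $\theta=(x,u)$ with $x=(x_0,\dots,x_N)$, $u=(u_0,\dots,u_N)$. For $\varepsilon\in[0,1]$ consider the chance-constrained problem $$\min_{x\in\mathbb X,\,u\in\mathbb U}\ \sum_{k=0}^N J(x_k,u_k)\quad\text{s.t.}\quad x_0=x_{\mathrm{init}},\quad x_{k+1}=f(x_k,u_k)\ (0\le k<N),\quad \mathbb P[\delta : g(x,\delta)\le 0]\ge 1-\varepsilon, \tag{CCP}$$ and, for a multi-sample $\omega=(\delta^{(1)},\dots,\delta^{(m)})\in\Delta^m$, the scenario program (SP) obtained by replacing the last constraint by $g(x,\delta^{(i)})\le 0$ for $i=1,\dots,m$. Let $\mathcal A$ be a decision algorithm, which assigns a decision $\mathcal A(\omega)$ to each $\omega\in\Delta^m$, $m=0,1,2,\dots$. Assume that for every $m\ge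 1$ and every $\omega\in\Delta^m$ the decision $\mathcal A(\omega)$ is a feasible (not necessarily optimal) point of the SP for $\omega$; in particular it satisfies the constraint of every sampled scenario. Assume also that for every $m\ge 0$ the set $\{(\omega,\delta)\in\Delta^m\times\Delta : \mathcal A(\omega)=(x,u)\in\mathbb X\times\mathbb U,\ g(x,\delta)\le 0\}$ is measurable. A support subsample of $\omega=(\delta^{(1)},\dots,\delta^{(S)})$, of size $n$, is a tuple $(\delta^{(i_1)},\dots,\delta^{(i_n)})$ with $i_1<\dots<i_n$ such that $\mathcal A(\delta^{(i_1)},\dots,\delta^{(i_n)})=\mathcal A(\omega)$. Let $\varepsilon\in[0,1]$, $\beta\in(0,1)$, a support limit $\bar n\ge 0$ and a sample size $S\ge 1$ be such that $\varepsilon(\bar n)\le\varepsilon$, where $$\varepsilon(n)=\begin{cases}1-\left(\dfrac{\beta}{S\binom{S}{n}}\right)^{\frac1{S-n}}, & n\le\bar n \text{ and } n<S,\\[2mm] 1, & \text{otherwise.}\end{cases}$$ Let $\omega=(\delta^{(1)},\dots,\delta^{(S)})$ be drawn from $\mathbb P^S=\mathbb P\times\dots\times\mathbb P$. Then, with confidence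 $1-\beta$, the scenario decision $\mathcal A(\omega)$ is feasible for (CCP) whenever it has a support subsample of size $n\le\bar n$; that is, $$\mathbb P^S\bigl[\,\omega \text{ has a support subsample of size } n\le\bar n \text{ and } \mathcal A(\omega) \text{ is not feasible for (CCP)}\,\bigr]\le\beta,$$ where $\mathbb P^S$ is read as outer measure if this event is not measurable. -/

import Mathlib

/-- Data shared by the chance-constrained problem and the scenario program: horizon `N`, state and
input dimensions `nx`, `nu`, and uncertainty space `Δ`. The constraint function `g` takes values in
`ℝ^q`, and `g x δ ≤ 0` is meant componentwise. -/
structure PlanningProblem (Δ : Type*) (N nx nu q : ℕ) where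
  /-- state constraints over the horizon -/
  X : Set (Fin (N + 1) → Fin nx → ℝ)
  /-- input constraints over the horizon -/
  U : Set (Fin (N + 1) → Fin nu → ℝ)
  /-- stage cost; it plays no role in feasibility -/
  J : (Fin nx → ℝ) → (Fin nu → ℝ) → ℝ
  /-- discrete-time dynamics -/
  f : (Fin nx → ℝ) → (Fin nu → ℝ) → (Fin nx → ℝ)
  /-- initial state -/
  xinit : Fin nx → ℝ
  /-- constraint function on trajectory and uncertainty -/
  g : (Fin (N + 1) → Fin nx → ℝ) → Δ → (Fin q → ℝ)

/-- A decision `θ = (x, u)`: a state trajectory and an input trajectory. -/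
abbrev Decision (N nx nu : ℕ) : Type :=
  (Fin (N + 1) → Fin nx → ℝ) × (Fin (N + 1) → Fin nu → ℝ)

/-- A decision algorithm maps multi-samples of every finite size to decisions (for size `0`,
the decision made without any scenario). -/
abbrev DecisionAlgorithm (Δ : Type*) (N nx nu : ℕ) : Type _ :=
  (m : ℕ) → (Fin m → Δ) → Decision N nx nu

namespace PlanningProblem

variable {Δ : Type*} {N nx nu q : ℕ}

/-- The decision set `Θ = 𝕏 × 𝕌`. -/
def decisionSet (P : PlanningProblem Δ N nx nu q) : Set (Decision N nx nu) :=
  P.X ×ˢ P.U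

/-- The set `Θ_δ ⊆ Θ` of decisions that satisfy the constraint imposed by the scenario `δ`. -/
def scenarioSet (P : PlanningProblem Δ N nx nu q) (δ : Δ) : Set (Decision N nx nu) :=
  {θ | θ ∈ P.decisionSet ∧ P.g θ.1 δ ≤ 0}

/-- The constraints common to the chance-constrained problem and the scenario program: state and
input constraints, initial condition, and dynamics. -/
def NominallyFeasible (P : PlanningProblem Δ N nx nu q) (θ : Decision N nx nu) : Prop :=
  θ ∈ P.decisionSet ∧ θ.1 0 = P.xinit ∧
    ∀ k : Fin N, θ.1 k.succ = P.f (θ.1 k.castSucc) (θ.2 k.castSucc)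

/-- Feasibility for the chance-constrained problem with risk level `ε`. -/
def FeasibleCCP [MeasurableSpace Δ] (P : PlanningProblem Δ N nx nu q)
    (μ : MeasureTheory.Measure Δ) (ε : ℝ) (θ : Decision N nx nu) : Prop :=
  P.NominallyFeasible θ ∧ 1 - ε ≤ μ.real {δ | P.g θ.1 δ ≤ 0}

/-- For every sample size `m ≥ 1` and every multi-sample, the decision satisfies the constraint of
every sampled scenario. -/
def SatisfiesSampledScenarios (P : PlanningProblem Δ N nx nu q)
    (A : DecisionAlgorithm Δ N nx nu) : Prop :=
  ∀ m : ℕ, 1 ≤ m → ∀ (ω : Fin m → Δ) (i : Fin m), A m ω ∈ P.scenarioSet (ω i)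

end PlanningProblem

/-- The scenarios with indices `i 0 < i 1 < ⋯ < i (n - 1)` form a support subsample of `ω`: the
algorithm returns the same decision on them as on the whole multi-sample. -/
def IsSupportSubsample {Δ : Type*} {N nx nu : ℕ} (A : DecisionAlgorithm Δ N nx nu)
    {S : ℕ} (ω : Fin S → Δ) {n : ℕ} (i : Fin n ↪o Fin S) : Prop :=
  A n (fun j => ω (i j)) = A S ω

/-- The risk function that splits `β` evenly over the support sizes:
`1 - (β / (S * (S choose n))) ^ (1 / (S - n))` for `n ≤ nbar`, and `1` for `n > nbar`;
the value at `n = S` is always `1`. -/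
noncomputable def evenSplitRisk (β : ℝ) (S nbar n : ℕ) : ℝ :=
  if n ≤ nbar ∧ n < S then
    1 - (β / ((S : ℝ) * (S.choose n : ℝ))) ^ (1 / ((S : ℝ) - (n : ℝ)))
  else 1

/-!
Fix a support size `n` and an index set of that size. Given the `n` scenarios it selects, the
decision made from them is fixed, and each of the other `S - n` independent scenarios satisfies it
with the same probability; if that probability is below `1 - ε`, all of them do with probability at
most `(1 - ε) ^ (S - n)`. A union bound over the index sets bounds the failure probability by
`∑ n ≤ nbar, (S choose n) * (1 - ε) ^ (S - n)`. The hypothesis `ε(nbar) ≤ ε` makes the last term at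
most `β / S`. The binomial terms are unimodal in `n` and end at `1` for `n = S`, so a term below `1`
dominates all earlier ones, and each of the at most `S` summands is at most `β / S`.
-/

open MeasureTheory

section BinomialTerms

variable {K : Type*} [Field K] [LinearOrder K] [IsStrictOrderedRing K] {S k n m : ℕ} {t : K}

lemma choose_mul_pow_mul_sub_eq {R : Type*} [CommRing R] (t : R) (hk : k < S) :
    S.choose k * t ^ (S - k) * (S - k) =
      S.choose (k + 1) * t ^ (S - (k + 1)) * ((k + 1) * t) := by
  have hpow : t ^ (S - k) = t ^ (S - (k + 1)) * t := by
    rw [← pow_succ, Nat.sub_add_eq, Nat.sub_add_cancel (Nat.sub_pos_of_lt hk)]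
  have hchoose : (S.choose (k + 1) : R) * (k + 1) = S.choose k * (S - k) := by
    rw [← Nat.cast_sub hk.le]
    exact_mod_cast congrArg (Nat.cast (R := R)) (Nat.choose_succ_right_eq S k)
  rw [hpow]
  linear_combination -(t ^ (S - (k + 1)) * t) * hchoose

lemma one_le_choose_mul_pow (ht : 0 ≤ t) (hkS : k ≤ S) (hkt : (S : K) - k ≤ (k + 1) * t) :
    1 ≤ S.choose k * t ^ (S - k) := by
  induction hkS using Nat.decreasingInduction with
  | self => simp
  | of_succ k hk ih =>
    have hgap : (0 : K) < S - k := sub_pos.2 (Nat.cast_lt.2 hk)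
    have hnext : (S : K) - (k + 1 : ℕ) ≤ ((k + 1 : ℕ) + 1) * t := by
      push_cast
      linarith
    refine (ih hnext).trans (le_of_mul_le_mul_right ?_ (hgap.trans_le hkt))
    rw [← choose_mul_pow_mul_sub_eq t hk]
    gcongr

lemma choose_mul_pow_le_succ_of_lt_one (ht : 0 ≤ t) (hk : k < S)
    (hlt : S.choose (k + 1) * t ^ (S - (k + 1)) < 1) :
    S.choose k * t ^ (S - k) ≤ S.choose (k + 1) * t ^ (S - (k + 1)) := by
  have hgap : (0 : K) < S - k := sub_pos.2 (Nat.cast_lt.2 hk)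
  have hkt : (k + 1) * t ≤ (S : K) - k := by
    by_contra! hgt
    refine hlt.not_ge (one_le_choose_mul_pow ht hk ?_)
    push_cast
    linarith
  refine le_of_mul_le_mul_right ?_ hgap
  rw [choose_mul_pow_mul_sub_eq t hk]
  gcongr

lemma choose_mul_pow_le_of_lt_one (ht : 0 ≤ t) (hnm : n ≤ m) (hmS : m ≤ S)
    (hlt : S.choose m * t ^ (S - m) < 1) :
    S.choose n * t ^ (S - n) ≤ S.choose m * t ^ (S - m) := by
  induction hnm using Nat.decreasingInduction with
  | self => exact le_rfl
  | of_succ k hk ih =>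
    exact (choose_mul_pow_le_succ_of_lt_one ht (hk.trans_le hmS) (ih.trans_lt hlt)).trans ih

lemma sum_choose_mul_pow_le {b : K} (ht : 0 ≤ t) (hmS : m < S) (hb : b < 1)
    (h : S.choose m * t ^ (S - m) ≤ b / S) :
    ∑ n ∈ Finset.Iic m, S.choose n * t ^ (S - n) ≤ b := by
  have hS : (1 : K) ≤ S := Nat.one_le_cast.2 (Nat.one_le_of_lt hmS)
  have hb_div : 0 ≤ b / S := le_trans (by positivity) h
  have hcancel : S * (b / S) = b := mul_div_cancel₀ b (by positivity)
  have hlt : S.choose m * t ^ (S - m) < 1 := calc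
    _ ≤ b / S := h
    _ ≤ S * (b / S) := le_mul_of_one_le_left hb_div hS
    _ < 1 := hcancel.trans_lt hb
  calc ∑ n ∈ Finset.Iic m, S.choose n * t ^ (S - n)
      ≤ ∑ _n ∈ Finset.Iic m, b / S := Finset.sum_le_sum fun n hn =>
        (choose_mul_pow_le_of_lt_one ht (Finset.mem_Iic.1 hn) hmS.le hlt).trans h
    _ = (m + 1 : ℕ) * (b / S) := by rw [Finset.sum_const, Nat.card_Iic, nsmul_eq_mul]
    _ ≤ S * (b / S) := by gcongr; exact hmS
    _ = b := hcancel

end BinomialTerms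

section EvenSplitRisk

variable {β ε : ℝ} {S nbar : ℕ}

lemma lt_of_evenSplitRisk_lt_one (h : evenSplitRisk β S nbar nbar < 1) : nbar < S := by
  by_contra hS
  simp [evenSplitRisk, hS] at h

lemma choose_mul_pow_le_of_evenSplitRisk_le (hβ : 0 ≤ β) (hε : ε ≤ 1) (hS : nbar < S)
    (h : evenSplitRisk β S nbar nbar ≤ ε) :
    S.choose nbar * (1 - ε) ^ (S - nbar) ≤ β / S := by
  have hchoose : (0 : ℝ) < S.choose nbar := Nat.cast_pos.2 (Nat.choose_pos hS.le)
  rw [evenSplitRisk, if_pos ⟨le_rfl, hS⟩, sub_le_comm, one_div, ← Nat.cast_sub hS.le] at h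
  rw [← le_div_iff₀' hchoose, div_div]
  calc (1 - ε) ^ (S - nbar)
      ≤ ((β / (S * S.choose nbar)) ^ ((S - nbar : ℕ) : ℝ)⁻¹) ^ (S - nbar) :=
        pow_le_pow_left₀ (sub_nonneg.2 hε) h _
    _ = β / (S * S.choose nbar) :=
        Real.rpow_inv_natCast_pow (by positivity) (Nat.sub_ne_zero_of_lt hS)

end EvenSplitRisk

section ProductMeasure

variable {Δ : Type*} [MeasurableSpace Δ] (μ : Measure Δ) (t : ENNReal)

lemma prod_pi_setOf_section_le [SigmaFinite μ] {α κ : Type*} [MeasurableSpace α] [Fintype κ]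
    (ν : Measure α) {D : Set (α × Δ)} (hD : MeasurableSet D) :
    (ν.prod (Measure.pi fun _ : κ => μ))
      {p | μ (Prod.mk p.1 ⁻¹' D) ≤ t ∧ ∀ k, (p.1, p.2 k) ∈ D} ≤
        t ^ Fintype.card κ * ν Set.univ := by
  have hmeas : MeasurableSet
      {p : α × (κ → Δ) | μ (Prod.mk p.1 ⁻¹' D) ≤ t ∧ ∀ k, (p.1, p.2 k) ∈ D} := by
    refine (measurableSet_le ((measurable_measure_prodMk_left hD).comp measurable_fst)
      measurable_const).inter (measurableSet_setOfPred.2 (.forall fun k => ?_))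
    have hpair : Measurable fun p : α × (κ → Δ) => (p.1, p.2 k) := by fun_prop
    exact measurableSet_setOfPred.1 (hpair hD)
  rw [Measure.prod_apply hmeas, ← lintegral_const]
  refine lintegral_mono fun a => ?_
  by_cases ha : μ (Prod.mk a ⁻¹' D) ≤ t
  · calc _ ≤ Measure.pi (fun _ : κ => μ) (Set.univ.pi fun _ => Prod.mk a ⁻¹' D) :=
          measure_mono fun b hb k _ => hb.2 k
      _ = μ (Prod.mk a ⁻¹' D) ^ Fintype.card κ := by
          rw [Measure.pi_pi, Finset.prod_const, Finset.card_univ]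
      _ ≤ t ^ Fintype.card κ := by gcongr
  · simp [ha]

lemma pi_setOf_section_comp_le [IsProbabilityMeasure μ] {ι τ : Type*} [Fintype ι] [Fintype τ]
    (i : ι ↪ τ) {D : Set ((ι → Δ) × Δ)} (hD : MeasurableSet D) :
    Measure.pi (fun _ : τ => μ)
      {ω | μ (Prod.mk (ω ∘ i) ⁻¹' D) ≤ t ∧ ∀ k, (ω ∘ i, ω k) ∈ D} ≤
        t ^ (Fintype.card τ - Fintype.card ι) := by
  classical
  let restrict (a : Set.range i → Δ) : ι → Δ := fun j => a ⟨i j, j, rfl⟩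
  let D' : Set ((Set.range i → Δ) × Δ) := Prod.map restrict id ⁻¹' D
  have hD' : MeasurableSet D' := (by fun_prop : Measurable (Prod.map restrict id)) hD
  have hcard : Fintype.card {k // k ∉ Set.range i} = Fintype.card τ - Fintype.card ι := by
    rw [Fintype.card_subtype_compl, Set.card_range_of_injective i.injective]
  have hsplit := measurePreserving_piEquivPiSubtypeProd (fun _ : τ => μ) (· ∈ Set.range i)
  refine (measure_mono ?_).trans <| (hsplit.measure_preimage_le _).trans <|
    (prod_pi_setOf_section_le μ t _ hD').trans_eq ?_
  · exact fun ω hω => ⟨hω.1, fun k => hω.2 k⟩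
  · rw [measure_univ, mul_one, hcard]

end ProductMeasure

lemma card_fin_orderEmbedding_fin (n S : ℕ) : Fintype.card (Fin n ↪o Fin S) = S.choose n := by
  rw [← Nat.card_eq_fintype_card, Nat.card_congr Set.powersetCard.ofFinEmbEquiv,
    Set.powersetCard.card, Nat.card_fin]

section ScenarioDecision

variable {Δ Θ : Type*} [MeasurableSpace Δ] (μ : Measure Δ) [IsProbabilityMeasure μ]
  (A : (m : ℕ) → (Fin m → Δ) → Θ) (C : Δ → Set Θ) {S : ℕ}

lemma pi_exists_support_measure_le {sizes : Finset ℕ}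
    (hmeas : ∀ n ∈ sizes, MeasurableSet {p : (Fin n → Δ) × Δ | A n p.1 ∈ C p.2})
    (hA : ∀ (ω : Fin S → Δ) k, A S ω ∈ C (ω k)) (t : ℕ → ENNReal) :
    Measure.pi (fun _ : Fin S => μ)
        {ω | ∃ n ∈ sizes, (∃ i : Fin n ↪o Fin S, A n (ω ∘ i) = A S ω) ∧
          μ {δ | A S ω ∈ C δ} ≤ t n} ≤
      ∑ n ∈ sizes, S.choose n * t n ^ (S - n) := by
  let D (n : ℕ) : Set ((Fin n → Δ) × Δ) := {p | A n p.1 ∈ C p.2}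
  let E (n : ℕ) (i : Fin n ↪o Fin S) : Set (Fin S → Δ) :=
    {ω | μ (Prod.mk (ω ∘ i) ⁻¹' D n) ≤ t n ∧ ∀ k, (ω ∘ i, ω k) ∈ D n}
  have hE (n) (hn : n ∈ sizes) (i) : Measure.pi (fun _ : Fin S => μ) (E n i) ≤ t n ^ (S - n) := by
    have hle := pi_setOf_section_comp_le μ (t n) i.toEmbedding (hmeas n hn)
    rwa [Fintype.card_fin, Fintype.card_fin] at hle
  calc _ ≤ Measure.pi (fun _ : Fin S => μ) (⋃ n ∈ sizes, ⋃ i, E n i) := by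
        refine measure_mono ?_
        rintro ω ⟨n, hn, ⟨i, hi⟩, hμ⟩
        refine Set.mem_biUnion hn (Set.mem_iUnion.2 ⟨i, ?_, fun k => ?_⟩)
        · simpa only [D, Set.preimage_ofPred_eq, hi] using hμ
        · simpa only [D, Set.mem_ofPred_eq, hi] using hA ω k
    _ ≤ ∑ n ∈ sizes, ∑ i, Measure.pi (fun _ : Fin S => μ) (E n i) :=
        (measure_biUnion_finset_le _ _).trans
          (Finset.sum_le_sum fun n _ => measure_iUnion_fintype_le _ _)
    _ ≤ ∑ n ∈ sizes, ∑ _i : Fin n ↪o Fin S, t n ^ (S - n) :=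
        Finset.sum_le_sum fun n hn => Finset.sum_le_sum fun i _ => hE n hn i
    _ = ∑ n ∈ sizes, S.choose n * t n ^ (S - n) := by
        simp only [Finset.sum_const, Finset.card_univ, card_fin_orderEmbedding_fin, nsmul_eq_mul]

theorem theorem1_general {ε β : ℝ} {nbar : ℕ}
    (hmeas : ∀ n ≤ nbar, MeasurableSet {p : (Fin n → Δ) × Δ | A n p.1 ∈ C p.2})
    (hA : ∀ (ω : Fin S → Δ) k, A S ω ∈ C (ω k)) (hβ : β ∈ Set.Ico 0 1)
    (hrisk : evenSplitRisk β S nbar nbar ≤ ε) :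
    Measure.pi (fun _ : Fin S => μ)
        {ω | (∃ n ≤ nbar, ∃ i : Fin n ↪o Fin S, A n (ω ∘ i) = A S ω) ∧
          μ.real {δ | A S ω ∈ C δ} < 1 - ε} ≤
      ENNReal.ofReal β := by
  obtain hε | hε := le_or_gt 1 ε
  · have hnonneg (ω : Fin S → Δ) : 1 - ε ≤ μ.real {δ | A S ω ∈ C δ} :=
      (sub_nonpos.2 hε).trans measureReal_nonneg
    simp [(hnonneg _).not_gt]
  have hSn : nbar < S := lt_of_evenSplitRisk_lt_one (hrisk.trans_lt hε)
  have ht : 0 ≤ 1 - ε := sub_nonneg.2 hε.le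
  calc _ ≤ ∑ n ∈ Finset.Iic nbar, S.choose n * ENNReal.ofReal (1 - ε) ^ (S - n) := by
        refine (measure_mono ?_).trans <| pi_exists_support_measure_le μ A C
          (fun n hn => hmeas n (Finset.mem_Iic.1 hn)) hA fun _ => ENNReal.ofReal (1 - ε)
        rintro ω ⟨⟨n, hn, hsupport⟩, hlt⟩
        exact ⟨n, Finset.mem_Iic.2 hn, hsupport,
          (ENNReal.le_ofReal_iff_toReal_le (measure_ne_top _ _) ht).2 hlt.le⟩
    _ = ENNReal.ofReal (∑ n ∈ Finset.Iic nbar, S.choose n * (1 - ε) ^ (S - n)) := by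
        rw [ENNReal.ofReal_sum_of_nonneg fun n _ => by positivity]
        simp only [ENNReal.ofReal_mul (Nat.cast_nonneg _), ENNReal.ofReal_natCast,
          ENNReal.ofReal_pow ht]
    _ ≤ ENNReal.ofReal β := ENNReal.ofReal_le_ofReal <| sum_choose_mul_pow_le ht hSn hβ.2 <|
        choose_mul_pow_le_of_evenSplitRisk_le hβ.1 hε.le hSn hrisk

end ScenarioDecision

lemma PlanningProblem.NominallyFeasible.feasibleCCP_iff {Δ : Type*} [MeasurableSpace Δ]
    {N nx nu q : ℕ} {P : PlanningProblem Δ N nx nu q} {θ : Decision N nx nu}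
    (hθ : P.NominallyFeasible θ) (μ : Measure Δ) (ε : ℝ) :
    P.FeasibleCCP μ ε θ ↔ 1 - ε ≤ μ.real {δ | θ ∈ P.scenarioSet δ} := by
  simp only [FeasibleCCP, scenarioSet, Set.mem_ofPred_eq, hθ, hθ.1, true_and]

theorem theorem1 {Δ : Type*} [MeasurableSpace Δ] (μ : MeasureTheory.Measure Δ)
    [MeasureTheory.IsProbabilityMeasure μ] {N nx nu q : ℕ}
    (P : PlanningProblem Δ N nx nu q) (A : DecisionAlgorithm Δ N nx nu)
    -- the event that a fresh scenario is satisfied by the scenario decision is measurable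
    (hmeas : ∀ m : ℕ,
      MeasurableSet {p : (Fin m → Δ) × Δ | A m p.1 ∈ P.scenarioSet p.2})
    -- the algorithm returns decisions that meet the scenario-independent constraints
    (hnom : ∀ m : ℕ, 1 ≤ m → ∀ ω : Fin m → Δ, P.NominallyFeasible (A m ω))
    -- and that satisfy every sampled scenario
    (hA : P.SatisfiesSampledScenarios A)
    (ε β : ℝ) (hε : ε ∈ Set.Icc (0 : ℝ) 1) (hβ : β ∈ Set.Ioo (0 : ℝ) 1)
    (nbar S : ℕ) (hS : 1 ≤ S) (hrisk : evenSplitRisk β S nbar nbar ≤ ε) :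
    MeasureTheory.Measure.pi (fun _ : Fin S => μ)
        {ω : Fin S → Δ |
          (∃ n : ℕ, n ≤ nbar ∧ ∃ i : Fin n ↪o Fin S, IsSupportSubsample A ω i) ∧
            ¬ P.FeasibleCCP μ ε (A S ω)}
      ≤ ENNReal.ofReal β := by
  refine (measure_mono ?_).trans <|
    theorem1_general μ A P.scenarioSet (fun n _ => hmeas n) (hA S hS) ⟨hβ.1.le, hβ.2⟩ hrisk
  rintro ω ⟨hsupport, hinfeasible⟩
  exact ⟨hsupport, not_le.1 (mt ((hnom S hS ω).feasibleCCP_iff μ ε).2 hinfeasible)⟩
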